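/- Let $N\ge 1$. A pure $N$-particle state is a function $\Psi\in L^2(\mathbb{R}^{3N})$ with $\|\Psi\|_{L^2}=1$ that is totally symmetric or totally antisymmetric under permutations of its $N$ arguments in $\mathbb{R}^3$. The set $\mathcal{D}_N$ of mixed $N$-particle states consists of the $\Gamma\in L^2(\mathbb{R}^{3N}\times\mathbb{R}^{3N})$ that have a decomposition $$\Gamma(x,y)=\sum_i p_i\Psi_i(x)\overline{\Psi_i(y)}\quad\text{a.e.}$$ into countably many pure states $\Psi_i$, with $p_i\ge 0$ and $\sum_i p_i=1$. To such a decomposition belong the reduced density matrix and the density $$D_\Gamma(r,s)=N\sum_i p_i\int_{\mathbb{R}^{3N-3}}\Psi_i(r,t)\overline{\Psi_i(s,t)}\,dt,\qquad \rho_\Gamma(r)=D_\Gamma(r,r)=N\sum_i p_i\int_{\mathbb{R}^{3N-3}}|\Psi_i(r,t)|^2\,dt .$$ For $D\in L^2(\mathbb{R}^3\times\mathbb{R}^3)$ write $\Gamma\mapsto D$ if $D_\Gamma=D$ almost everywhere on $\mathbb{R}^3\times\mathbb{R}^3$ for some decomposition of $\Gamma$, and let $\mathcal{D}_{N,1}$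 be the set of all $D$ such that $\Gamma\mapsto D$ for some $\Gamma\in\mathcal{D}_N$. For $G\in L^2(\mathbb{R}^3\times\mathbb{R}^3)$ put $$(G^\dagger\ast G)(r,s)=\int_{\mathbb{R}^3}\overline{G(u,r)}\,G(u,s)\,du .$$ Let $D\in\mathcal{D}_{N,1}$. (a) Let $G\in L^2(\mathbb{R}^3\times\mathbb{R}^3)$ satisfy $D=G^\dagger\ast G$ almost everywhere on $\mathbb{R}^3\times\mathbb{R}^3$. Then for every $\Gamma\in\mathcal{D}_N$ with $\Gamma\mapsto D$, and for every decomposition of $\Gamma$ into pure states, the integrals and the series that define $\rho_\Gamma(r)$ and $(G^\dagger\ast G)(r,r)$ converge and $$\rho_\Gamma(r)=(G^\dagger\ast G)(r,r)$$ for almost every $r\in\mathbb{R}^3$. (b) Consequently the diagonal (density) $\rho_D(r)=(G^\dagger\ast G)(r,r)$ of $D$ is well defined almost everywhere: a factorization $D=G^\dagger\ast G$ a.e. with $G\in L^2(\mathbb{R}^3\times\mathbb{R}^3)$ exists, and if $D=G^\dagger\ast G=G'^\dagger\ast G'$ almost everywhere with $G,G'\in L^2(\mathbb{R}^3\times\mathbb{R}^3)$,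 then $(G^\dagger\ast G)(r,r)=(G'^\dagger\ast G')(r,r)$ for almost every $r\in\mathbb{R}^3$. -/

import Mathlib

open MeasureTheory
open scoped ComplexConjugate ENNReal

noncomputable section

namespace DensityMatrix

/-- One-particle configuration space `ℝ³`, with its Euclidean structure and Lebesgue measure. -/
abbrev Space : Type := EuclideanSpace ℝ (Fin 3)

/-- Configuration space `(ℝ³)^N` of `N` particles, with Lebesgue measure. -/
abbrev Config (N : ℕ) : Type := Fin N → Space

/-- Composition of integral kernels: `(B ∗ C)(x, y) = ∫ B(x, z) C(z, y) dz`. -/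
def kernelComp {X Z Y : Type*} [MeasureSpace Z] (B : X × Z → ℂ) (C : Z × Y → ℂ) : X × Y → ℂ :=
  fun q => ∫ z, B (q.1, z) * C (z, q.2)

/-- The adjoint kernel: `G†(x, y) = conj (G(y, x))`. -/
def kernelAdjoint {X Y : Type*} (G : X × Y → ℂ) : Y × X → ℂ :=
  fun q => conj (G (q.2, q.1))

/-- `Ψ` is totally symmetric under permutations of the particles. -/
def IsSymm {N : ℕ} (Ψ : Config N → ℂ) : Prop :=
  ∀ σ : Equiv.Perm (Fin N), ∀ᵐ x, Ψ (x ∘ σ) = Ψ x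

/-- `Ψ` is totally antisymmetric under permutations of the particles. -/
def IsAntisymm {N : ℕ} (Ψ : Config N → ℂ) : Prop :=
  ∀ σ : Equiv.Perm (Fin N), ∀ᵐ x, Ψ (x ∘ σ) = ((Equiv.Perm.sign σ : ℤ) : ℂ) * Ψ x

/-- A (spin-free) pure `N`-particle state: a normalized square-integrable wave function that is
totally symmetric or totally antisymmetric. -/
structure IsPureState {N : ℕ} (Ψ : Config N → ℂ) : Prop where
  memLp : MemLp Ψ 2 volume
  norm_eq_one : ∫ x, ‖Ψ x‖ ^ 2 = 1
  symm_or_antisymm : IsSymm Ψ ∨ IsAntisymm Ψ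

/-- A countable convex combination of pure `N`-particle states. Finite combinations are the case
where all but finitely many weights vanish. -/
structure Ensemble (N : ℕ) where
  p : ℕ → ℝ
  Ψ : ℕ → Config N → ℂ
  p_nonneg : ∀ i, 0 ≤ p i
  p_sum : HasSum p 1
  pure : ∀ i, IsPureState (Ψ i)

namespace Ensemble

/-- The `N`-particle density matrix `∑ᵢ pᵢ Ψᵢ(x) conj (Ψᵢ(y))` of an ensemble. -/
def kernel {N : ℕ} (e : Ensemble N) : Config N × Config N → ℂ :=
  fun q => ∑' i, (e.p i : ℂ) * (e.Ψ i q.1 * conj (e.Ψ i q.2))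

/-- The one-particle reduced density matrix of an ensemble of `N = n + 1` particles,
`N ∑ᵢ pᵢ ∫ Ψᵢ(r, r₂, …, r_N) conj (Ψᵢ(s, r₂, …, r_N)) dr₂ ⋯ dr_N`. -/
def rdm {n : ℕ} (e : Ensemble (n + 1)) : Space × Space → ℂ :=
  fun q => ((n + 1 : ℕ) : ℂ) * ∑' i, (e.p i : ℂ) *
    ∫ t : Config n, e.Ψ i (Fin.cons q.1 t) * conj (e.Ψ i (Fin.cons q.2 t))

/-- The density `ρ(r) = D_Γ(r, r)`, where `D_Γ` is the pointwise defined reduced density matrix. -/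
def density {n : ℕ} (e : Ensemble (n + 1)) : Space → ℂ :=
  fun r => e.rdm (r, r)

theorem density_eq {n : ℕ} (e : Ensemble (n + 1)) (r : Space) :
    e.density r =
      (((n + 1 : ℕ) * ∑' i, e.p i * ∫ t : Config n, ‖e.Ψ i (Fin.cons r t)‖ ^ 2 : ℝ) : ℂ) := by
  simp only [density, rdm, Complex.mul_conj']
  push_cast
  congr 2
  funext i
  congr 1
  rw [← integral_complex_ofReal]
  simp

/-- The integrals and the series in the formula for the density at `r` all converge. -/
def DensityConvergesAt {n : ℕ} (e : Ensemble (n + 1)) (r : Space) : Prop :=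
  (∀ i, Integrable fun t : Config n => ‖e.Ψ i (Fin.cons r t)‖ ^ 2) ∧
    Summable fun i => e.p i * ∫ t : Config n, ‖e.Ψ i (Fin.cons r t)‖ ^ 2

end Ensemble

/-- The ensemble `e` is a decomposition of `Γ` into pure states:
`Γ(x, y) = ∑ᵢ pᵢ Ψᵢ(x) conj (Ψᵢ(y))` almost everywhere. -/
def IsDecomposition {N : ℕ} (e : Ensemble N)
    (Γ : Lp ℂ 2 (volume : Measure (Config N × Config N))) : Prop :=
  Γ =ᵐ[volume] e.kernel

/-- The set `𝒟_N` of mixed `N`-particle states, as elements of `L²(ℝ^{3N} × ℝ^{3N})`. -/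
def mixedStates (N : ℕ) : Set (Lp ℂ 2 (volume : Measure (Config N × Config N))) :=
  {Γ | ∃ e : Ensemble N, IsDecomposition e Γ}

/-- `Γ ↦ D`: the reduced density matrix of `Γ` equals `D` almost everywhere. -/
def MapsToRdm {n : ℕ} (Γ : Lp ℂ 2 (volume : Measure (Config (n + 1) × Config (n + 1))))
    (D : Lp ℂ 2 (volume : Measure (Space × Space))) : Prop :=
  ∃ e : Ensemble (n + 1), IsDecomposition e Γ ∧ e.rdm =ᵐ[volume] D

/-- The set `𝒟_{N,1}`, `N = n + 1`, of one-particle reduced density matrices that belong to some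
mixed `N`-particle state. -/
def oneRdms (n : ℕ) : Set (Lp ℂ 2 (volume : Measure (Space × Space))) :=
  {D | ∃ Γ ∈ mixedStates (n + 1), MapsToRdm Γ D}

/-- `G` is a Hilbert–Schmidt kernel with `D = G† ∗ G` almost everywhere. -/
def IsFactorization (G : Space × Space → ℂ)
    (D : Lp ℂ 2 (volume : Measure (Space × Space))) : Prop :=
  MemLp G 2 volume ∧ D =ᵐ[volume] kernelComp (kernelAdjoint G) G

end DensityMatrix

end

noncomputable section

namespace DensityMatrix

/-! The diagonal is a null set, so an identity of kernels a.e. says nothing about it directly. But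
every kernel here is a Gram kernel `⟨f r, f s⟩`, with `f r` the slice at `r` of a square-integrable
function. If `(f x, f x)` misses a closed set `C`, so does some basic square `U ×ˢ U` around it;
then the square of `f ⁻¹' U` is null, hence `f ⁻¹' U` is null, and countably many `U` suffice. With
equality of two inner products as the closed relation, `ae_gram_diag_eq` follows. It is used twice:
on `Space`, to compare `rdm` with `G† ∗ G`; and on `Config (n + 1)`, to show that the density does
not depend on the decomposition. A factorization exists because Parseval turns any Gram kernel into
one over `ℕ`, and counting measure on `ℕ` is an image of Lebesgue measure on a strip of `Space`. -/

/-- A closed relation that holds for almost all pairs of values of `f` holds on the diagonal.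
No measurability of `f` is needed. -/
theorem ae_diag_mem_of_ae_prod {X M : Type*} [MeasurableSpace X] {μ : Measure X} [SFinite μ]
    [TopologicalSpace M] [SecondCountableTopology M] {f : X → M} {C : Set (M × M)}
    (hC : IsClosed C) (h : ∀ᵐ q ∂μ.prod μ, (f q.1, f q.2) ∈ C) :
    ∀ᵐ x ∂μ, (f x, f x) ∈ C := by
  have hnull : ∀ U ∈ TopologicalSpace.countableBasis M, U ×ˢ U ⊆ Cᶜ →
      ∀ᵐ x ∂μ, f x ∉ U := by
    intro U _ hU
    have h0 : μ.prod μ ((f ⁻¹' U) ×ˢ (f ⁻¹' U)) = 0 :=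
      measure_mono_null (fun q hq => hU (Set.mk_mem_prod hq.1 hq.2)) (ae_iff.1 h)
    -- The product formula holds for arbitrary sets, measurable or not.
    rw [Measure.prod_prod, mul_self_eq_zero] at h0
    exact measure_mono_null (fun x hx => not_not.1 hx) h0
  have hall : ∀ᵐ x ∂μ, ∀ U ∈ TopologicalSpace.countableBasis M, U ×ˢ U ⊆ Cᶜ → f x ∉ U := by
    rw [ae_ball_iff (TopologicalSpace.countable_countableBasis M)]
    intro U hU
    by_cases hUC : U ×ˢ U ⊆ Cᶜ
    · filter_upwards [hnull U hU hUC] with x hx _ using hx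
    · exact .of_forall fun x h => absurd h hUC
  filter_upwards [hall] with x hx
  by_contra hxC
  obtain ⟨V, hV, W, hW, hVW⟩ := mem_nhds_prod_iff.1 (hC.isOpen_compl.mem_nhds hxC)
  obtain ⟨U, hU, hxU, hUVW⟩ := (TopologicalSpace.isBasis_countableBasis M).mem_nhds_iff.1
    (Filter.inter_mem hV hW)
  exact hx U hU ((Set.prod_mono (hUVW.trans Set.inter_subset_left)
    (hUVW.trans Set.inter_subset_right)).trans hVW) hxU

section Gram

variable {X Z W : Type*} [MeasurableSpace X] [MeasurableSpace Z] [MeasurableSpace W]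
  {μ : Measure X} {ν : Measure Z} {ω : Measure W}

/-- The kernel `(A† ∗ A)(r, s)` with an explicit measure on the integrated variable. -/
def gram (ν : Measure Z) (A : Z × X → ℂ) (r s : X) : ℂ :=
  ∫ z, conj (A (z, r)) * A (z, s) ∂ν

theorem inner_toLp {f g : Z → ℂ} (hf : MemLp f 2 ν) (hg : MemLp g 2 ν) :
    inner ℂ (hf.toLp f) (hg.toLp g) = ∫ z, conj (f z) * g z ∂ν := by
  rw [L2.inner_def]
  refine integral_congr_ae ?_
  filter_upwards [hf.coeFn_toLp, hg.coeFn_toLp] with z h1 h2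
  rw [h1, h2, RCLike.inner_apply, mul_comm]

theorem integrable_conj_mul {f g : Z → ℂ} (hf : MemLp f 2 ν) (hg : MemLp g 2 ν) :
    Integrable (fun z => conj (f z) * g z) ν :=
  hf.star.integrable_mul hg

theorem ae_memLp_slice [SFinite μ] [SFinite ν] {A : Z × X → ℂ} (hA : MemLp A 2 (ν.prod μ)) :
    ∀ᵐ r ∂μ, MemLp (fun z => A (z, r)) 2 ν := by
  have h1 := ((memLp_two_iff_integrable_sq_norm hA.1).1 hA).prod_left_ae
  have h2 : ∀ᵐ r ∂μ, AEStronglyMeasurable (fun z => A (z, r)) ν :=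
    hA.1.prod_swap.prodMk_left
  filter_upwards [h1, h2] with r h1 h2
  exact (memLp_two_iff_integrable_sq_norm h2).2 h1

theorem ae_prod_and {P : X → Prop} [SFinite μ] (h : ∀ᵐ r ∂μ, P r) :
    ∀ᵐ q ∂μ.prod μ, P q.1 ∧ P q.2 := by
  filter_upwards [Measure.quasiMeasurePreserving_fst.ae h,
    Measure.quasiMeasurePreserving_snd.ae h] with q h1 h2 using ⟨h1, h2⟩

/-- Two factorizations of the same kernel have the same diagonal. -/
theorem ae_gram_diag_eq [SFinite μ] [SFinite ν] [SFinite ω]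
    [MeasurableSpace.CountablyGenerated Z] [MeasurableSpace.CountablyGenerated W]
    {A : Z × X → ℂ} {B : W × X → ℂ} (hA : MemLp A 2 (ν.prod μ)) (hB : MemLp B 2 (ω.prod μ))
    (h : ∀ᵐ q ∂μ.prod μ, gram ν A q.1 q.2 = gram ω B q.1 q.2) :
    ∀ᵐ r ∂μ, gram ν A r r = gram ω B r r := by
  classical
  -- With the countably generated σ-algebras, this makes both `L²` spaces second countable.
  have : Fact ((2 : ℝ≥0∞) ≠ ∞) := ⟨by simp⟩
  -- The two slices are paired so that one closed relation compares them; the value 0 occurs only on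
  -- a null set.
  let f : X → Lp ℂ 2 ν × Lp ℂ 2 ω := fun r =>
    if hr : MemLp (fun z => A (z, r)) 2 ν ∧ MemLp (fun z => B (z, r)) 2 ω
    then (hr.1.toLp, hr.2.toLp) else 0
  have hf : ∀ r, MemLp (fun z => A (z, r)) 2 ν ∧ MemLp (fun z => B (z, r)) 2 ω →
      ∀ s, MemLp (fun z => A (z, s)) 2 ν ∧ MemLp (fun z => B (z, s)) 2 ω →
      inner ℂ (f r).1 (f s).1 = gram ν A r s ∧ inner ℂ (f r).2 (f s).2 = gram ω B r s := by
    intro r hr s hs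
    simp only [f, dif_pos hr, dif_pos hs, inner_toLp]
    exact ⟨rfl, rfl⟩
  have hgood := (ae_memLp_slice hA).and (ae_memLp_slice hB)
  have hC : IsClosed {q : (Lp ℂ 2 ν × Lp ℂ 2 ω) × (Lp ℂ 2 ν × Lp ℂ 2 ω) |
      inner ℂ q.1.1 q.2.1 = inner ℂ q.1.2 q.2.2} :=
    isClosed_eq (by fun_prop) (by fun_prop)
  have := ae_diag_mem_of_ae_prod (μ := μ) (f := f) hC (by
    filter_upwards [h, ae_prod_and hgood] with q hq hg
    have := hf _ hg.1 _ hg.2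
    change inner ℂ _ _ = inner ℂ _ _
    rw [this.1, this.2, hq])
  filter_upwards [this, hgood] with r h1 h2
  have h3 := hf _ h2 _ h2
  change inner ℂ _ _ = inner ℂ _ _ at h1
  rwa [h3.1, h3.2] at h1

theorem ae_count_prod {P : ℕ × X → Prop} [SFinite μ] (h : ∀ i, ∀ᵐ x ∂μ, P (i, x)) :
    ∀ᵐ q ∂(Measure.count : Measure ℕ).prod μ, P q := by
  have : {q : ℕ × X | ¬ P q} = ⋃ i, {i} ×ˢ {x | ¬ P (i, x)} := by
    ext ⟨i, x⟩; simp
  rw [ae_iff, this, measure_iUnion_null_iff]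
  intro i
  rw [Measure.prod_prod, ae_iff.1 (h i), mul_zero]

theorem aestronglyMeasurable_count_prod {A : ℕ × X → ℂ} [SFinite μ]
    (h : ∀ i, AEStronglyMeasurable (fun x => A (i, x)) μ) :
    AEStronglyMeasurable A ((Measure.count : Measure ℕ).prod μ) := by
  refine ⟨fun q => (h q.1).mk _ q.2, ?_, ae_count_prod fun i => (h i).ae_eq_mk⟩
  exact (measurable_from_prod_countable_right
    fun i => (h i).stronglyMeasurable_mk.measurable).stronglyMeasurable

end Gram

/-! ### Ensembles as Gram kernels -/

theorem integral_count_eq_tsum {E : Type*} [NormedAddCommGroup E] [NormedSpace ℝ E]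
    [CompleteSpace E] {f : ℕ → E} (hf : Integrable f Measure.count) :
    ∫ i, f i ∂(Measure.count : Measure ℕ) = ∑' i, f i := by
  rw [integral_countable hf]
  simp [Measure.real]

theorem integral_count_prod {Y : Type*} [MeasurableSpace Y] {ρ : Measure Y} [SFinite ρ]
    {F : ℕ × Y → ℂ} (hF : Integrable F ((Measure.count : Measure ℕ).prod ρ)) :
    ∫ q, F q ∂(Measure.count : Measure ℕ).prod ρ = ∑' i, ∫ y, F (i, y) ∂ρ := by
  rw [integral_prod _ hF, integral_count_eq_tsum hF.integral_prod_left]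

/-- The remaining particles come first in the pair because `gram` integrates the first variable. -/
theorem measurePreserving_cons (n : ℕ) :
    MeasurePreserving (fun q : Config n × Space => (Fin.cons q.2 q.1 : Config (n + 1)))
      (volume.prod volume) volume := by
  have h := (volume_preserving_piFinSuccAbove (fun _ : Fin (n + 1) => Space) 0).symm
  have h2 : MeasurePreserving (Prod.swap : Config n × Space → Space × Config n)
    (volume.prod volume) (volume.prod volume) := Measure.measurePreserving_swap
  have h3 := h.comp h2
  have heq : ⇑(MeasurableEquiv.piFinSuccAbove (fun _ : Fin (n + 1) => Space) 0).symm ∘ Prod.swap =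
      fun q : Config n × Space => (Fin.cons q.2 q.1 : Config (n + 1)) := by
    funext q
    simp [MeasurableEquiv.piFinSuccAbove, Fin.insertNthEquiv]
  exact heq ▸ h3

theorem measurePreserving_cons_count (n : ℕ) :
    MeasurePreserving
      (fun q : (ℕ × Config n) × Space => (q.1.1, (Fin.cons q.2 q.1.2 : Config (n + 1))))
      (((Measure.count : Measure ℕ).prod volume).prod volume)
      ((Measure.count : Measure ℕ).prod volume) :=
  ((MeasurePreserving.id (Measure.count : Measure ℕ)).prod (measurePreserving_cons n)).comp
    (measurePreserving_prodAssoc (Measure.count : Measure ℕ)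
      (volume : Measure (Config n)) (volume : Measure Space))

namespace Ensemble

/-- The kernel `√pᵢ conj (Ψᵢ(x))`, a square root of the density matrix of the ensemble. -/
def amplitude {N : ℕ} (e : Ensemble N) : ℕ × Config N → ℂ :=
  fun q => (√(e.p q.1) : ℂ) * conj (e.Ψ q.1 q.2)

theorem memLp_amplitude {N : ℕ} (e : Ensemble N) :
    MemLp e.amplitude 2 ((Measure.count : Measure ℕ).prod volume) := by
  have hm : AEStronglyMeasurable e.amplitude ((Measure.count : Measure ℕ).prod volume) :=
    aestronglyMeasurable_count_prod fun i => (e.pure i).memLp.star.1.const_mul (√(e.p i) : ℂ)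
  have hsq : ∀ q, ‖e.amplitude q‖ ^ 2 = e.p q.1 * ‖e.Ψ q.1 q.2‖ ^ 2 := by
    intro q
    simp [amplitude, mul_pow, Real.sq_sqrt (e.p_nonneg q.1)]
  rw [memLp_two_iff_integrable_sq_norm hm, integrable_prod_iff (by fun_prop)]
  simp only [hsq]
  refine ⟨.of_forall fun i =>
    ((memLp_two_iff_integrable_sq_norm (e.pure i).memLp.1).1 (e.pure i).memLp).const_mul _, ?_⟩
  -- By normalization row `i` contributes `p i`, so the squared `L²` norm is `∑ p i = 1`.
  have : ∀ i, ∫ y, ‖e.p i * ‖e.Ψ i y‖ ^ 2‖ = e.p i := by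
    intro i
    simp only [norm_mul, norm_pow, norm_norm, Real.norm_of_nonneg (e.p_nonneg i)]
    rw [integral_const_mul, (e.pure i).norm_eq_one, mul_one]
  simp only [this]
  rw [integrable_count_iff]
  exact e.p_sum.summable.norm

theorem conj_amplitude_mul {N : ℕ} (e : Ensemble N) (i : ℕ) (x y : Config N) :
    conj (e.amplitude (i, x)) * e.amplitude (i, y) = e.p i * (e.Ψ i x * conj (e.Ψ i y)) := by
  have : ((√(e.p i) : ℝ) : ℂ) * (√(e.p i) : ℝ) = e.p i := by
    rw [← Complex.ofReal_mul, Real.mul_self_sqrt (e.p_nonneg i)]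
  simp only [amplitude, map_mul, Complex.conj_ofReal, Complex.conj_conj]
  rw [← this]; ring

theorem kernel_ae_eq_gram {N : ℕ} (e : Ensemble N) :
    ∀ᵐ q : Config N × Config N, e.kernel q = gram Measure.count e.amplitude q.1 q.2 := by
  filter_upwards [ae_prod_and (ae_memLp_slice e.memLp_amplitude)] with q hq
  rw [gram, integral_count_eq_tsum (integrable_conj_mul hq.1 hq.2)]
  simp only [conj_amplitude_mul]
  rfl

/-- The kernel `√N √pᵢ conj (Ψᵢ(r, t))`, a square root of the reduced density matrix. -/
def reducedAmplitude {n : ℕ} (e : Ensemble (n + 1)) : (ℕ × Config n) × Space → ℂ :=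
  fun q => (√((n + 1 : ℕ) : ℝ) : ℂ) * e.amplitude (q.1.1, Fin.cons q.2 q.1.2)

theorem memLp_reducedAmplitude {n : ℕ} (e : Ensemble (n + 1)) :
    MemLp e.reducedAmplitude 2 (((Measure.count : Measure ℕ).prod volume).prod volume) :=
  (e.memLp_amplitude.comp_measurePreserving (measurePreserving_cons_count n)).const_mul _

theorem conj_reducedAmplitude_mul {n : ℕ} (e : Ensemble (n + 1)) (z : ℕ × Config n)
    (r s : Space) :
    conj (e.reducedAmplitude (z, r)) * e.reducedAmplitude (z, s) =
      ((n + 1 : ℕ) : ℂ) * (conj (e.amplitude (z.1, Fin.cons r z.2)) *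
        e.amplitude (z.1, Fin.cons s z.2)) := by
  have : ((√((n + 1 : ℕ) : ℝ) : ℝ) : ℂ) * (√((n + 1 : ℕ) : ℝ) : ℝ) = ((n + 1 : ℕ) : ℂ) := by
    rw [← Complex.ofReal_mul, Real.mul_self_sqrt (by positivity), Complex.ofReal_natCast]
  simp only [reducedAmplitude, map_mul, Complex.conj_ofReal]
  rw [← this]; ring

/-- The conditions bear on `r` and `s` separately, so the identity is also available at `s = r` for
almost every `r`. -/
theorem rdm_eq_gram {n : ℕ} (e : Ensemble (n + 1)) {r s : Space}
    (hr : MemLp (fun z => e.reducedAmplitude (z, r)) 2 ((Measure.count : Measure ℕ).prod volume))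
    (hs : MemLp (fun z => e.reducedAmplitude (z, s)) 2 ((Measure.count : Measure ℕ).prod volume)) :
    e.rdm (r, s) = gram ((Measure.count : Measure ℕ).prod volume) e.reducedAmplitude r s := by
  rw [gram, integral_count_prod (integrable_conj_mul hr hs)]
  simp only [conj_reducedAmplitude_mul, conj_amplitude_mul, integral_const_mul, tsum_mul_left]
  rfl

theorem rdm_ae_eq_gram {n : ℕ} (e : Ensemble (n + 1)) :
    ∀ᵐ q : Space × Space, e.rdm q =
      gram ((Measure.count : Measure ℕ).prod volume) e.reducedAmplitude q.1 q.2 := by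
  filter_upwards [ae_prod_and (ae_memLp_slice e.memLp_reducedAmplitude)] with q hq
  exact e.rdm_eq_gram hq.1 hq.2

theorem density_ae_eq_gram {n : ℕ} (e : Ensemble (n + 1)) :
    ∀ᵐ r : Space, e.density r =
      gram ((Measure.count : Measure ℕ).prod volume) e.reducedAmplitude r r := by
  filter_upwards [ae_memLp_slice e.memLp_reducedAmplitude] with r hr
  exact e.rdm_eq_gram hr hr

theorem ae_densityConvergesAt {n : ℕ} (e : Ensemble (n + 1)) :
    ∀ᵐ r : Space, e.DensityConvergesAt r := by
  have h1 : ∀ᵐ r : Space, ∀ i, Integrable fun t : Config n => ‖e.Ψ i (Fin.cons r t)‖ ^ 2 := by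
    rw [ae_all_iff]
    intro i
    have := (memLp_two_iff_integrable_sq_norm (e.pure i).memLp.1).1 (e.pure i).memLp
    exact ((measurePreserving_cons n).integrable_comp_of_integrable this).prod_left_ae
  filter_upwards [h1, ae_memLp_slice e.memLp_reducedAmplitude] with r h1 h2
  refine ⟨h1, ?_⟩
  have h3 := ((memLp_two_iff_integrable_sq_norm h2.1).1 h2).integral_prod_left
  rw [integrable_count_iff] at h3
  have h4 : ∀ i t, ‖e.reducedAmplitude ((i, t), r)‖ ^ 2 =
      (n + 1 : ℝ) * (e.p i * ‖e.Ψ i (Fin.cons r t)‖ ^ 2) := by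
    intro i t
    simp only [reducedAmplitude, amplitude, norm_mul, mul_pow, Complex.norm_real,
      RCLike.norm_conj, Real.norm_eq_abs, sq_abs, Real.sq_sqrt (e.p_nonneg i)]
    rw [Real.sq_sqrt (by positivity)]
    push_cast; ring
  simp only [h4, integral_const_mul] at h3
  exact (summable_mul_left_iff (by positivity)).1 h3.of_norm

/-- Fubini with the ensemble index summed first: the density becomes an integral of the diagonal of
the `N`-particle kernel. -/
theorem ae_gram_reducedAmplitude_diag {n : ℕ} (e : Ensemble (n + 1)) :
    ∀ᵐ r : Space, gram ((Measure.count : Measure ℕ).prod volume) e.reducedAmplitude r r =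
      ((n + 1 : ℕ) : ℂ) * ∫ t : Config n,
        gram Measure.count e.amplitude (Fin.cons r t) (Fin.cons r t) := by
  filter_upwards [ae_memLp_slice e.memLp_reducedAmplitude] with r hr
  rw [gram, integral_prod_symm _ (integrable_conj_mul hr hr)]
  simp only [conj_reducedAmplitude_mul, integral_const_mul, gram]

/-- The density depends only on the density matrix, not on its decomposition. -/
theorem density_ae_eq_of_kernel_ae_eq {n : ℕ} {e e' : Ensemble (n + 1)}
    (h : e.kernel =ᵐ[volume] e'.kernel) : e.density =ᵐ[volume] e'.density := by
  have h1 : ∀ᵐ x : Config (n + 1), gram Measure.count e.amplitude x x =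
      gram Measure.count e'.amplitude x x := by
    refine ae_gram_diag_eq e.memLp_amplitude e'.memLp_amplitude ?_
    filter_upwards [h, e.kernel_ae_eq_gram, e'.kernel_ae_eq_gram] with q h1 h2 h3
    rw [← h2, ← h3, h1]
  have h2 := Measure.ae_ae_of_ae_prod
    (Measure.measurePreserving_swap.quasiMeasurePreserving.ae
      ((measurePreserving_cons n).quasiMeasurePreserving.ae h1))
  filter_upwards [h2, e.density_ae_eq_gram, e'.density_ae_eq_gram,
    e.ae_gram_reducedAmplitude_diag, e'.ae_gram_reducedAmplitude_diag] with r h2 h3 h4 h5 h6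
  rw [h3, h4, h5, h6, integral_congr_ae (f := fun t => gram Measure.count e.amplitude (Fin.cons r t) (Fin.cons r t)) h2]
  rfl

end Ensemble

/-! ### Existence of a factorization -/

/-- A Parseval identity indexed by `ℕ` in every separable Hilbert space. -/
theorem exists_parseval_sequence (H : Type*) [NormedAddCommGroup H] [InnerProductSpace ℂ H]
    [CompleteSpace H] [SecondCountableTopology H] :
    ∃ b : ℕ → H, ∀ x y, HasSum (fun k => inner ℂ x (b k) * inner ℂ (b k) y) (inner ℂ x y) := by
  obtain ⟨w, b, hb⟩ := exists_hilbertBasis ℂ H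
  have hw : Countable w := by
    -- Orthonormal vectors are `√2` apart, so balls of radius 1/2 are disjoint, and separability
    -- leaves only countably many.
    have hdist : ∀ i j : w, i ≠ j → 1 ≤ dist (b i) (b j) := by
      intro i j hij
      have h1 := @norm_sub_sq ℂ H _ _ _ (b i) (b j)
      rw [b.orthonormal.2 hij, b.orthonormal.1 i, b.orthonormal.1 j] at h1
      rw [dist_eq_norm]
      norm_num at h1
      nlinarith [norm_nonneg (b i - b j)]
    refine Set.countable_univ_iff.1 ?_
    refine Set.PairwiseDisjoint.countable_of_isOpen (s := fun i : w => Metric.ball (b i) (1 / 2))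
      ?_ (fun _ _ => Metric.isOpen_ball) (fun i _ => ⟨b i, Metric.mem_ball_self (by norm_num)⟩)
    intro i _ j _ hij
    exact Metric.ball_disjoint_ball (by linarith [hdist i j hij])
  obtain ⟨f, hf⟩ := hw.exists_injective_nat
  -- Padding with zero vectors also covers finite bases.
  refine ⟨Function.extend f b 0, fun x y => ?_⟩
  rw [← hf.hasSum_iff]
  · simpa [Function.comp_def, hf.extend_apply] using b.hasSum_inner_mul_inner x y
  · intro k hk
    rw [Function.extend_apply' _ _ _ (by simpa using hk)]
    simp

section

variable {X Z : Type*} [MeasurableSpace X] [MeasurableSpace Z] {μ : Measure X} {ν : Measure Z}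

/-- Expanding a Hilbert–Schmidt kernel in an orthonormal basis turns it into a kernel on `ℕ × X`
with the same Gram kernel. -/
theorem exists_count_gram_eq [SFinite μ] [SFinite ν] [MeasurableSpace.CountablyGenerated Z]
    {A : Z × X → ℂ} (hA : MemLp A 2 (ν.prod μ)) :
    ∃ C : ℕ × X → ℂ, MemLp C 2 ((Measure.count : Measure ℕ).prod μ) ∧
      ∀ᵐ q ∂μ.prod μ, gram ν A q.1 q.2 = gram Measure.count C q.1 q.2 := by
  have : Fact ((2 : ℝ≥0∞) ≠ ∞) := ⟨by simp⟩
  obtain ⟨b, hb⟩ := exists_parseval_sequence (Lp ℂ 2 ν)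
  let C : ℕ × X → ℂ := fun q => ∫ z, conj (b q.1 z) * A (z, q.2) ∂ν
  have hgood := ae_memLp_slice hA
  have hCeq : ∀ r (hr : MemLp (fun z => A (z, r)) 2 ν) k, C (k, r) = inner ℂ (b k) hr.toLp := by
    intro r hr k
    have := inner_toLp (Lp.memLp (b k)) hr
    rw [Lp.toLp_coeFn] at this
    exact this.symm
  have hsum : ∀ r (hr : MemLp (fun z => A (z, r)) 2 ν) s (hs : MemLp (fun z => A (z, s)) 2 ν),
      HasSum (fun k => conj (C (k, r)) * C (k, s)) (gram ν A r s) := by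
    intro r hr s hs
    have := hb hr.toLp hs.toLp
    rw [inner_toLp hr hs] at this
    simpa only [hCeq r hr, hCeq s hs, inner_conj_symm, gram] using this
  have hnorm : ∀ a : ℂ, conj a * a = ((‖a‖ ^ 2 : ℝ) : ℂ) := fun a => by
    rw [mul_comm, Complex.mul_conj']; push_cast; rfl
  have hsq : ∀ r, MemLp (fun z => A (z, r)) 2 ν →
      HasSum (fun k => ‖C (k, r)‖ ^ 2) (∫ z, ‖A (z, r)‖ ^ 2 ∂ν) := by
    intro r hr
    have := hsum r hr r hr
    simp only [gram, hnorm] at this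
    rwa [integral_complex_ofReal, Complex.hasSum_ofReal] at this
  have hslice : ∀ r, MemLp (fun z => A (z, r)) 2 ν →
      Integrable (fun k => ‖C (k, r)‖ ^ 2) Measure.count := by
    intro r hr
    rw [integrable_count_iff]
    exact (hsq r hr).summable.norm
  have hCm : AEStronglyMeasurable C ((Measure.count : Measure ℕ).prod μ) := by
    refine aestronglyMeasurable_count_prod fun k => ?_
    refine AEStronglyMeasurable.integral_prod_right' (μ := μ) (ν := ν)
      (f := fun q : X × Z => conj (b k q.2) * A (q.2, q.1)) ?_
    exact ((Lp.memLp (b k)).star.1.comp_snd).mul hA.1.prod_swap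
  refine ⟨C, ?_, ?_⟩
  · rw [memLp_two_iff_integrable_sq_norm hCm, integrable_prod_iff' (by fun_prop)]
    refine ⟨by filter_upwards [hgood] with r hr using hslice r hr, ?_⟩
    refine ((memLp_two_iff_integrable_sq_norm hA.1).1 hA).integral_prod_right.congr ?_
    filter_upwards [hgood] with r hr
    simp only [norm_pow, norm_norm]
    rw [integral_count_eq_tsum (hslice r hr), (hsq r hr).tsum_eq]
  · filter_upwards [ae_prod_and hgood] with q hq
    have h1 := hsum _ hq.1 _ hq.2
    have hmem : ∀ r, MemLp (fun z => A (z, r)) 2 ν →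
        MemLp (fun k => C (k, r)) 2 Measure.count := fun r hr =>
      (memLp_two_iff_integrable_sq_norm (by fun_prop)).2 (hslice r hr)
    rw [← h1.tsum_eq, gram,
      integral_count_eq_tsum (integrable_conj_mul (hmem _ hq.1) (hmem _ hq.2))]

end

/-- A strip of `ℝ³` on which the integer part of the first coordinate pushes Lebesgue measure
to counting measure on `ℕ`. -/
theorem exists_measurePreserving_restrict_count :
    ∃ (Q : Set Space) (κ : Space → ℕ), MeasurableSet Q ∧
      MeasurePreserving κ (volume.restrict Q) Measure.count := by
  let Q : Set Space := {u | 0 ≤ u 0 ∧ u 1 ∈ Set.Ico (0 : ℝ) 1 ∧ u 2 ∈ Set.Ico (0 : ℝ) 1}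
  have hQ : MeasurableSet Q := by
    have h (i : Fin 3) : Measurable fun u : Space => u i := by fun_prop
    exact (h 0 measurableSet_Ici).inter ((h 1 measurableSet_Ico).inter (h 2 measurableSet_Ico))
  have hκ : Measurable fun u : Space => ⌊u 0⌋₊ := Nat.measurable_floor.comp (by fun_prop)
  refine ⟨Q, fun u => ⌊u 0⌋₊, hQ, hκ, ?_⟩
  refine Measure.ext_of_singleton fun k => ?_
  rw [Measure.map_apply hκ (by simp), Measure.restrict_apply (hκ (by simp)),
    Measure.count_singleton]
  -- The fibre over `k` is the unit cube `[k, k+1) × [0,1)²`, of volume 1.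
  have hset : (fun u : Space => ⌊u 0⌋₊) ⁻¹' {k} ∩ Q = (WithLp.ofLp : Space → Fin 3 → ℝ) ⁻¹'
      Set.pi Set.univ ![Set.Ico (k : ℝ) (k + 1), Set.Ico 0 1, Set.Ico 0 1] := by
    ext u
    simp only [Set.mem_inter_iff, Set.mem_preimage, Set.mem_singleton_iff, Set.mem_univ_pi,
      Fin.forall_fin_succ, Q]
    constructor
    · rintro ⟨h0, h1, h2, h3⟩
      have := (Nat.floor_eq_iff h1).1 h0
      simp_all
    · intro h
      have h0 : (0 : ℝ) ≤ u 0 := le_trans (Nat.cast_nonneg k) h.1.1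
      exact ⟨(Nat.floor_eq_iff h0).2 h.1, h0, h.2.1, h.2.2.1⟩
  rw [hset, (PiLp.volume_preserving_ofLp (Fin 3)).measure_preimage, volume_pi_pi]
  · simp [Fin.prod_univ_succ]
  · refine (MeasurableSet.univ_pi fun i => ?_).nullMeasurableSet
    fin_cases i <;> exact measurableSet_Ico

/-- Every Gram kernel over a separable `L²` space is `G† ∗ G` for some `G` in `L²(ℝ³ × X)`. -/
theorem exists_gram_space_eq {X Z : Type*} [MeasurableSpace X] [MeasurableSpace Z]
    {μ : Measure X} {ν : Measure Z} [SFinite μ] [SFinite ν]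
    [MeasurableSpace.CountablyGenerated Z] {A : Z × X → ℂ} (hA : MemLp A 2 (ν.prod μ)) :
    ∃ G : Space × X → ℂ, MemLp G 2 (volume.prod μ) ∧
      ∀ᵐ q ∂μ.prod μ, gram ν A q.1 q.2 = gram volume G q.1 q.2 := by
  obtain ⟨C, hC, hAC⟩ := exists_count_gram_eq hA
  obtain ⟨Q, κ, hQ, hκ⟩ := exists_measurePreserving_restrict_count
  refine ⟨(Q ×ˢ Set.univ).indicator fun q => C (κ q.1, q.2), ?_, ?_⟩
  · rw [memLp_indicator_iff_restrict (hQ.prod .univ), ← Measure.prod_restrict,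
      Measure.restrict_univ]
    exact hC.comp_measurePreserving (hκ.prod (MeasurePreserving.id μ))
  · filter_upwards [hAC] with q hq
    have hind : ∀ u, conj ((Q ×ˢ Set.univ).indicator (fun q : Space × X => C (κ q.1, q.2))
          (u, q.1)) * (Q ×ˢ Set.univ).indicator (fun q : Space × X => C (κ q.1, q.2)) (u, q.2) =
        Q.indicator (fun u => conj (C (κ u, q.1)) * C (κ u, q.2)) u := by
      intro u
      by_cases hu : u ∈ Q <;> simp [hu]
    rw [hq]
    simp only [gram, hind]
    rw [integral_indicator hQ, ← hκ.map_eq, integral_map hκ.aemeasurable (by fun_prop)]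

end DensityMatrix

end

theorem mainTheorem4 (n : ℕ)
    (D : MeasureTheory.Lp ℂ 2
      (MeasureTheory.volume : MeasureTheory.Measure (DensityMatrix.Space × DensityMatrix.Space)))
    (hD : D ∈ DensityMatrix.oneRdms n) :
    -- every factorization of `D` yields the density of every state that reduces to `D`
    (∀ G : DensityMatrix.Space × DensityMatrix.Space → ℂ, DensityMatrix.IsFactorization G D →
      ∀ Γ ∈ DensityMatrix.mixedStates (n + 1), DensityMatrix.MapsToRdm Γ D →
      ∀ e : DensityMatrix.Ensemble (n + 1), DensityMatrix.IsDecomposition e Γ →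
      ∀ᵐ r : DensityMatrix.Space,
        e.DensityConvergesAt r ∧
        MeasureTheory.Integrable (fun u : DensityMatrix.Space =>
          DensityMatrix.kernelAdjoint G (r, u) * G (u, r)) ∧
        e.density r =
          DensityMatrix.kernelComp (DensityMatrix.kernelAdjoint G) G (r, r)) ∧
    -- the diagonal of `D` is well defined: there is a factorization, and all factorizations
    -- have the same diagonal almost everywhere
    (∃ G : DensityMatrix.Space × DensityMatrix.Space → ℂ, DensityMatrix.IsFactorization G D) ∧
    (∀ G G' : DensityMatrix.Space × DensityMatrix.Space → ℂ,
      DensityMatrix.IsFactorization G D → DensityMatrix.IsFactorization G' D →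
      ∀ᵐ r : DensityMatrix.Space,
        DensityMatrix.kernelComp (DensityMatrix.kernelAdjoint G) G (r, r) =
          DensityMatrix.kernelComp (DensityMatrix.kernelAdjoint G') G' (r, r)) := by
  open DensityMatrix in
  have key : ∀ e : Ensemble (n + 1), e.rdm =ᵐ[volume] D → ∀ G, IsFactorization G D →
      ∀ᵐ r : Space, e.density r = kernelComp (kernelAdjoint G) G (r, r) := by
    intro e he G hG
    have hgram := ae_gram_diag_eq e.memLp_reducedAmplitude hG.1 (by
      filter_upwards [he, hG.2, e.rdm_ae_eq_gram] with q h1 h2 h3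
      rw [← h3, h1, h2]
      rfl)
    filter_upwards [hgram, e.density_ae_eq_gram] with r h1 h2
    rw [h2, h1]
    rfl
  obtain ⟨Γ₀, -, e₀, -, he₀⟩ := hD
  refine ⟨?_, ?_, ?_⟩
  · rintro G hG Γ - ⟨e', he'Γ, he'D⟩ e heΓ
    -- Only the decomposition `e'` is known to reduce to `D`; its density is carried over to the
    -- arbitrary `e` through `Γ`.
    have hdens := DensityMatrix.Ensemble.density_ae_eq_of_kernel_ae_eq (heΓ.symm.trans he'Γ)
    filter_upwards [e.ae_densityConvergesAt, DensityMatrix.ae_memLp_slice hG.1, hdens,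
      key e' he'D G hG] with r h1 h2 h3 h4
    exact ⟨h1, DensityMatrix.integrable_conj_mul h2 h2, h3.trans h4⟩
  · obtain ⟨G, hG, h⟩ := DensityMatrix.exists_gram_space_eq e₀.memLp_reducedAmplitude
    refine ⟨G, hG, ?_⟩
    filter_upwards [h, he₀, e₀.rdm_ae_eq_gram] with q h1 h2 h3
    rw [← h2, h3, h1]
    rfl
  · intro G G' hG hG'
    filter_upwards [key e₀ he₀ G hG, key e₀ he₀ G' hG'] with r h1 h2
    rw [← h1, h2]
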